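/- Connected spaces are non-empty. A connected space $Y$ is called irreducible if there are two distinct points $p,q\in Y$ such that every connected set $C\subseteq Y$ containing both $p$ and $q$ is dense in $Y$. A compactification of a space $X$ is a compact Hausdorff space containing $X$ as a dense subspace; it is an $n$-point compactification if exactly $n$ of its points lie outside $X$. (So a space with a one-point compactification is not compact.) Let $X$ be a separable metrizable space. Then: (1) $X$ is connected, locally connected, locally compact and non-compact, and its one-point compactification is irreducible, if and only if $X$ is homeomorphic to $[0,1)$. (2) $X$ is connected, locally connected and locally compact, and has an irreducible two-point compactification, if and only if $X$ is homeomorphic to $\mathbb R$. -/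

import Mathlib

open Set Topology TopologicalSpace

universe u

/-- The space `Y` is reducible between `p` and `q`: some connected subset of `Y` contains both
points and is not dense in `Y`. -/
def ReducibleBetween {Y : Type u} [TopologicalSpace Y] (p q : Y) : Prop :=
  ∃ C : Set Y, IsConnected C ∧ p ∈ C ∧ q ∈ C ∧ closure C ≠ univ

/-- A connected space is irreducible if it is irreducible between some two of its points
(this is not Mathlib's `IrreducibleSpace`, the notion of algebraic geometry). -/
def IsIrreducibleConnected (Y : Type u) [TopologicalSpace Y] : Prop :=
  ConnectedSpace Y ∧ ∃ p q : Y, p ≠ q ∧ ¬ ReducibleBetween p q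

/-- `e : X → Y` is a two-point compactification of `X`: a dense embedding into a compact Hausdorff
space whose remainder has exactly two points. -/
structure IsTwoPointCompactification {X Y : Type u} [TopologicalSpace X] [TopologicalSpace Y]
    (e : X → Y) : Prop where
  compact : CompactSpace Y
  hausdorff : T2Space Y
  isDenseEmbedding : IsDenseEmbedding e
  remainder : ((range e)ᶜ).encard = 2

/-!
Let `Y` be a compact Hausdorff space containing the connected, locally connected, separable space
`X` as a dense subspace with finite complement, and suppose that `Y` is irreducible between `p`
and `q`. Both characterizations follow from the fact that `Y` is then an arc with end points `p`
and `q`, and that all points of `Y` outside `X` are among these two end points.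

Local connectedness passes from `X` to `Y` (`locallyConnectedSpace_of_finite_compl`): a continuum
cannot fail to be locally connected at an isolated point of the bad set. Indeed, for open sets
`A' ⊆ closure A' ⊆ A` around such a point `p`, only finitely many components of `A \ {p}` meet the
compact frontier of `A'`, and a component that misses this frontier but meets `A'` has `p` in its
closure, as it would be clopen otherwise.

In a locally connected regular space, any two points of a connected open set `U` lie in a connected
set whose closure is contained in `U` (`exists_isConnected_closure_subset`). Hence no connected
open proper subset of `Y` contains both `p` and `q`, so a point outside `X`, whose complement is
connected, is `p` or `q`; and removing any point `x` separates `p` from `q`. By irreducibility `Y`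
is the union of `{x}` and the components of `p` and `q` in the complement of `x`. Declaring `x < y`
when `x` is in the component of `p` in `{y}ᶜ` gives a linear order with least element `p` and
greatest element `q`; its rays are open, so by compactness it induces the topology of `Y`
(`exists_linearOrder_orderTopology`).

A separable connected linear order with two end points is isomorphic to the extended real line, by
Cantor's theorem on countable dense orders and completion (`exists_orderIso_ereal`). The extended
real line serves as the model arc throughout: `[0, 1)` is `EReal` without `⊤`, and `ℝ` is `EReal`
without `⊥` and `⊤`. Conversely, these inclusions are compactifications, and a connected subset of
`EReal` that contains `⊥` and `⊤` is everything.
-/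

/-! ### Local connectedness at isolated points -/

theorem isPreconnected_insert_of_mem_closure {Y : Type*} [TopologicalSpace Y] {S : Set Y} {x : Y}
    (hS : IsPreconnected S) (hx : x ∈ closure S) : IsPreconnected (insert x S) :=
  hS.subset_closure (subset_insert _ _) (insert_subset hx subset_closure)

/-- Otherwise `S` would be clopen. -/
theorem mem_closure_of_isOpen_of_forall_ne {Y : Type*} [TopologicalSpace Y]
    [PreconnectedSpace Y] {S : Set Y} {x : Y} (hne : S.Nonempty) (hxS : x ∉ S)
    (ho : IsOpen S) (h : ∀ z ∈ closure S, z ≠ x → z ∈ S) : x ∈ closure S := by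
  by_contra hx
  have hc : IsClosed S := by
    refine isClosed_of_closure_subset fun z hz => h z hz ?_
    rintro rfl
    exact hx hz
  exact hxS ((IsClopen.eq_univ ⟨hc, ho⟩ hne) ▸ mem_univ x)

/-- Components of `W` that are neighbourhoods of their points are closed relative to `W`. The
hypothesis is on `W` alone because it is needed before `Y` is known to be locally connected. -/
theorem mem_connectedComponentIn_of_mem_closure {Y : Type*} [TopologicalSpace Y] {W : Set Y}
    {y z : Y} (hW : ∀ w ∈ W, connectedComponentIn W w ∈ 𝓝 w)
    (hz : z ∈ closure (connectedComponentIn W y)) (hzW : z ∈ W) :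
    z ∈ connectedComponentIn W y := by
  obtain ⟨w, hwz, hwy⟩ := mem_closure_iff_nhds.1 hz _ (hW z hzW)
  rw [connectedComponentIn_eq hwy, ← connectedComponentIn_eq hwz]
  exact mem_connectedComponentIn hzW

/-- A continuum that is locally connected off a finite closed set is locally connected. Near an
exceptional point `p`, the connected neighbourhood is the union of `{p}` and those components of
`A \ {p}` that have `p` in their closure. -/
theorem locallyConnectedSpace_of_finite_compl {Y : Type*} [TopologicalSpace Y] [CompactSpace Y]
    [T2Space Y] [PreconnectedSpace Y] {U : Set Y} (hU : IsOpen U) [LocallyConnectedSpace U]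
    (hF : Uᶜ.Finite) : LocallyConnectedSpace Y := by
  have hUcomp : ∀ W : Set Y, IsOpen W → W ⊆ U → ∀ w ∈ W, connectedComponentIn W w ∈ 𝓝 w := by
    intro W hW hWU w hw
    have hn : ((↑) ⁻¹' W : Set U) ∈ 𝓝 (⟨w, hWU hw⟩ : U) :=
      (hW.preimage continuous_subtype_val).mem_nhds hw
    obtain ⟨V, hVn, hVc, hVW⟩ := locallyConnectedSpace_iff_connected_subsets.1 ‹_› _ _ hn
    refine Filter.mem_of_superset (hU.isOpenEmbedding_subtypeVal.image_mem_nhds.2 hVn) ?_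
    exact (hVc.image _ continuous_subtype_val.continuousOn).subset_connectedComponentIn
      ⟨_, mem_of_mem_nhds hVn, rfl⟩ (image_subset_iff.2 hVW)
  refine locallyConnectedSpace_iff_connected_subsets.2 fun p N hN => ?_
  -- `A` avoids all exceptional points except possibly `p` itself.
  obtain ⟨A, hAsub, hA, hpA⟩ := mem_nhds_iff.1
    (Filter.inter_mem hN ((hF.subset (sdiff_subset (t := {p}))).isClosed.isOpen_compl.mem_nhds
      (show p ∈ (Uᶜ \ {p})ᶜ by simp)))
  obtain ⟨A', hA', hpA', hA'A⟩ : ∃ A' : Set Y, IsOpen A' ∧ p ∈ A' ∧ closure A' ⊆ A := by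
    obtain ⟨K, hK, hKc, hKA⟩ := exists_mem_nhds_isClosed_subset (hA.mem_nhds hpA)
    exact ⟨interior K, isOpen_interior, mem_interior_iff_mem_nhds.2 hK,
      (closure_minimal interior_subset hKc).trans hKA⟩
  set W : Set Y := A \ {p} with hWdef
  have hW : IsOpen W := hA.sdiff isClosed_singleton
  have hWU : W ⊆ U := by
    rintro w ⟨hwA, hwp⟩
    by_contra hwU
    exact (hAsub hwA).2 ⟨hwU, hwp⟩
  have hnhds := hUcomp W hW hWU
  have hfr : frontier A' ⊆ W := by
    intro w hw
    refine ⟨hA'A hw.1, ?_⟩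
    rintro rfl
    exact hw.2 (hA'.interior_eq.symm ▸ hpA')
  obtain ⟨t, htfr, ht⟩ := isClosed_frontier.isCompact.elim_nhds_subcover
    (fun w => connectedComponentIn W w) (s := frontier A') (fun w hw => hnhds w (hfr hw))
  refine ⟨⋃ y ∈ {y | y = p ∨ p ∈ closure (connectedComponentIn W y)},
    insert p (connectedComponentIn W y), ?_, ?_, ?_⟩
  -- Away from the closures of the finitely many components that meet the frontier of `A'` and stay
  -- away from `p`, every point of `A'` is in a component that accumulates at `p`.
  · have hO : IsOpen (A' \ ⋃ y ∈ {y ∈ (t : Set Y) | p ∉ closure (connectedComponentIn W y)},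
        closure (connectedComponentIn W y)) :=
      hA'.sdiff ((t.finite_toSet.subset (sep_subset _ _)).isClosed_biUnion
        fun _ _ => isClosed_closure)
    refine Filter.mem_of_superset (hO.mem_nhds ⟨hpA', ?_⟩) ?_
    · simp only [mem_iUnion, not_exists]
      exact fun y hy => hy.2
    · rintro z ⟨hzA', hzt⟩
      rw [mem_iUnion₂]
      by_cases hzp : z = p
      · exact ⟨p, Or.inl rfl, hzp ▸ mem_insert _ _⟩
      have hzW : z ∈ W := ⟨hA'A (subset_closure hzA'), hzp⟩
      refine ⟨z, Or.inr ?_, Or.inr (mem_connectedComponentIn hzW)⟩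
      by_contra hpz
      by_cases hmeet : (connectedComponentIn W z ∩ frontier A').Nonempty
      · obtain ⟨w, hwz, hwfr⟩ := hmeet
        obtain ⟨y, hyt, hwy⟩ := mem_iUnion₂.1 (ht hwfr)
        have hzy : connectedComponentIn W z = connectedComponentIn W y :=
          (connectedComponentIn_eq hwz).trans (connectedComponentIn_eq hwy).symm
        refine hzt (mem_iUnion₂.2 ⟨y, ⟨hyt, hzy ▸ hpz⟩, hzy ▸ ?_⟩)
        exact subset_closure (mem_connectedComponentIn hzW)
      -- The component of `z` stays away from `p` and from the frontier of `A'`, so it is clopen.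
      · have hsub : connectedComponentIn W z ⊆ A' := by
          refine isPreconnected_connectedComponentIn.subset_of_closure_inter_subset hA'
            ⟨z, mem_connectedComponentIn hzW, hzA'⟩ fun w hw => ?_
          by_contra hwA'
          exact hmeet ⟨w, hw.2, hA'.frontier_eq ▸ ⟨hw.1, hwA'⟩⟩
        refine hpz (mem_closure_of_isOpen_of_forall_ne
          ⟨z, mem_connectedComponentIn hzW⟩ ?_ ?_ ?_)
        · exact fun h => (connectedComponentIn_subset _ _ h).2 rfl
        · refine isOpen_iff_mem_nhds.2 fun w hw => ?_
          rw [connectedComponentIn_eq hw]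
          exact hnhds w (connectedComponentIn_subset _ _ hw)
        · exact fun w hw hwp => mem_connectedComponentIn_of_mem_closure hnhds hw
            ⟨hA'A (closure_mono hsub hw), hwp⟩
  · refine isPreconnected_of_forall p fun z hz => ?_
    obtain ⟨y, hy, hzy⟩ := mem_iUnion₂.1 hz
    refine ⟨insert p (connectedComponentIn W y), subset_biUnion_of_mem
      (u := fun y => insert p (connectedComponentIn W y)) hy, mem_insert _ _, hzy, ?_⟩
    rcases hy with rfl | hy
    -- The index `p` contributes `{p}`, since `p ∉ W` has an empty component in `W`.
    · rw [connectedComponentIn_eq_empty (by simp [hWdef])]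
      simpa using isPreconnected_singleton
    · exact isPreconnected_insert_of_mem_closure isPreconnected_connectedComponentIn hy
  · refine iUnion₂_subset fun y _ => ?_
    exact (insert_subset hpA ((connectedComponentIn_subset _ _).trans sdiff_subset)).trans
      fun w hw => (hAsub hw).1

/-! ### Points separating the two ends -/

/-- Two points of `U` are joined by a finite chain of connected sets with closures in `U`. -/
theorem exists_isConnected_closure_subset {Y : Type*} [TopologicalSpace Y] [RegularSpace Y]
    [LocallyConnectedSpace Y] {U : Set Y} (hU : IsOpen U) (hUc : IsPreconnected U) {p q : Y}
    (hp : p ∈ U) (hq : q ∈ U) : ∃ C, IsConnected C ∧ p ∈ C ∧ q ∈ C ∧ closure C ⊆ U := by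
  refine hUc.induction₂ (fun p q => ∃ C, IsConnected C ∧ p ∈ C ∧ q ∈ C ∧ closure C ⊆ U)
    (fun x hx => ?_) ?_ ?_ hp hq
  · obtain ⟨K, hK, hKc, hKU⟩ := exists_mem_nhds_isClosed_subset (hU.mem_nhds hx)
    obtain ⟨V, hVn, hVc, hVK⟩ := locallyConnectedSpace_iff_connected_subsets.1 ‹_› _ _ hK
    filter_upwards [mem_nhdsWithin_of_mem_nhds hVn] with y hy
    exact ⟨V, ⟨⟨y, hy⟩, hVc⟩, mem_of_mem_nhds hVn, hy, (closure_minimal hVK hKc).trans hKU⟩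
  · rintro x y z - - - ⟨C, hC, hxC, hyC, hCU⟩ ⟨D, hD, hyD, hzD, hDU⟩
    refine ⟨C ∪ D, hC.union ⟨y, hyC, hyD⟩ hD, Or.inl hxC, Or.inr hzD, ?_⟩
    rw [closure_union]
    exact union_subset hCU hDU
  · rintro x y - - ⟨C, hC, hxC, hyC, hCU⟩
    exact ⟨C, hC, hyC, hxC, hCU⟩

theorem not_isPreconnected_of_not_reducibleBetween {Y : Type*} [TopologicalSpace Y] [T3Space Y]
    [LocallyConnectedSpace Y] {p q x : Y} (h : ¬ ReducibleBetween p q) {U : Set Y} (hU : IsOpen U)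
    (hxU : x ∉ U) (hp : p ∈ U) (hq : q ∈ U) : ¬ IsPreconnected U := by
  intro hUc
  obtain ⟨C, hC, hpC, hqC, hCU⟩ := exists_isConnected_closure_subset hU hUc hp hq
  exact h ⟨C, hC, hpC, hqC, fun hu => hxU (hCU (hu ▸ mem_univ x))⟩

theorem mem_closure_connectedComponentIn_compl_singleton {Y : Type*} [TopologicalSpace Y]
    [T1Space Y] [LocallyConnectedSpace Y] [PreconnectedSpace Y] {x y : Y} (h : y ≠ x) :
    x ∈ closure (connectedComponentIn {x}ᶜ y) := by
  refine mem_closure_of_isOpen_of_forall_ne ⟨y, mem_connectedComponentIn h⟩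
    (fun hx => connectedComponentIn_subset _ _ hx rfl) isOpen_compl_singleton.connectedComponentIn
    fun z hz hzx => mem_connectedComponentIn_of_mem_closure (fun w hw => ?_) hz hzx
  exact connectedComponentIn_mem_nhds (isOpen_compl_singleton.mem_nhds hw)

theorem isPreconnected_insert_connectedComponentIn_compl {Y : Type*} [TopologicalSpace Y]
    [T1Space Y] [LocallyConnectedSpace Y] [PreconnectedSpace Y] (x y : Y) :
    IsPreconnected (insert x (connectedComponentIn {x}ᶜ y)) := by
  rcases eq_or_ne y x with rfl | h
  · rw [connectedComponentIn_eq_empty (by simp)]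
    simpa using isPreconnected_singleton
  · exact isPreconnected_insert_of_mem_closure isPreconnected_connectedComponentIn
      (mem_closure_connectedComponentIn_compl_singleton h)

theorem mem_insert_connectedComponentIn_compl_singleton {Y : Type*} [TopologicalSpace Y]
    (x y : Y) :
    y ∈ insert x (connectedComponentIn {x}ᶜ y) := by
  rcases eq_or_ne y x with rfl | h
  · exact mem_insert _ _
  · exact Or.inr (mem_connectedComponentIn h)

/-- Every point other than `p` and `q` separates `p` from `q`; if `x` is `p` or `q`, one of the two
sets is empty by the convention on `connectedComponentIn`. -/
theorem disjoint_connectedComponentIn_compl_singleton {Y : Type*} [TopologicalSpace Y] [T3Space Y]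
    [LocallyConnectedSpace Y] {p q : Y} (h : ¬ ReducibleBetween p q) (x : Y) :
    Disjoint (connectedComponentIn {x}ᶜ p) (connectedComponentIn {x}ᶜ q) := by
  rw [Set.disjoint_left]
  intro z hzp hzq
  have hpx : p ∈ ({x}ᶜ : Set Y) := by
    by_contra hp
    rw [connectedComponentIn_eq_empty hp] at hzp
    exact hzp
  have hqx : q ∈ ({x}ᶜ : Set Y) := by
    by_contra hq
    rw [connectedComponentIn_eq_empty hq] at hzq
    exact hzq
  refine not_isPreconnected_of_not_reducibleBetween h
    (isOpen_compl_singleton.connectedComponentIn (F := {x}ᶜ) (x := p))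
    (fun hx => connectedComponentIn_subset _ _ hx rfl) (mem_connectedComponentIn hpx) ?_
    isPreconnected_connectedComponentIn
  rw [connectedComponentIn_eq hzp, ← connectedComponentIn_eq hzq]
  exact mem_connectedComponentIn hqx

/-- The components of `p` and `q`, joined at `x`, form a connected set containing `p` and `q`, which
is dense by irreducibility and therefore meets the open component of any other point. -/
theorem mem_connectedComponentIn_compl_singleton_or {Y : Type*} [TopologicalSpace Y]
    [T1Space Y] [LocallyConnectedSpace Y] [PreconnectedSpace Y] {p q : Y}
    (h : ¬ ReducibleBetween p q) {x z : Y}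
    (hzx : z ≠ x) :
    z ∈ connectedComponentIn {x}ᶜ p ∨ z ∈ connectedComponentIn {x}ᶜ q := by
  have hdense : closure (insert x (connectedComponentIn {x}ᶜ p) ∪
      insert x (connectedComponentIn {x}ᶜ q)) = univ := by
    by_contra hne
    refine h ⟨_, ⟨⟨x, Or.inl (mem_insert _ _)⟩, ?_⟩,
      Or.inl (mem_insert_connectedComponentIn_compl_singleton x p),
      Or.inr (mem_insert_connectedComponentIn_compl_singleton x q), hne⟩
    exact (isPreconnected_insert_connectedComponentIn_compl x p).union x
      (mem_insert _ _) (mem_insert _ _)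
      (isPreconnected_insert_connectedComponentIn_compl x q)
  obtain ⟨w, hwz, hw⟩ := mem_closure_iff_nhds.1 (hdense ▸ mem_univ z)
    (connectedComponentIn {x}ᶜ z)
    (connectedComponentIn_mem_nhds (isOpen_compl_singleton.mem_nhds hzx))
  have hwx : w ≠ x := fun hwx => connectedComponentIn_subset _ _ hwz hwx
  have hz : z ∈ connectedComponentIn {x}ᶜ z := mem_connectedComponentIn hzx
  rw [connectedComponentIn_eq hwz] at hz
  rcases hw with (hw | hw) | (hw | hw)
  · exact absurd hw hwx
  · exact Or.inl (connectedComponentIn_eq hw ▸ hz)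
  · exact absurd hw hwx
  · exact Or.inr (connectedComponentIn_eq hw ▸ hz)

/-- The relation `x < y` can be read off from either end: `x` is on the side of `p` with respect to
`y` precisely when `y` is on the side of `q` with respect to `x`, the converse being this lemma with
`p` and `q` exchanged. -/
theorem mem_connectedComponentIn_compl_singleton_swap {Y : Type*} [TopologicalSpace Y] [T3Space Y]
    [LocallyConnectedSpace Y] [PreconnectedSpace Y] {p q : Y}
    (h : ¬ ReducibleBetween p q) {x y : Y}
    (hxy : x ∈ connectedComponentIn {y}ᶜ p) : y ∈ connectedComponentIn {x}ᶜ q := by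
  have hne : x ≠ y := fun he => connectedComponentIn_subset _ _ hxy he
  refine (isPreconnected_insert_connectedComponentIn_compl y q).subset_connectedComponentIn
    (mem_insert_connectedComponentIn_compl_singleton y q) ?_ (mem_insert _ _)
  rw [subset_compl_singleton_iff]
  rintro (he | hx)
  · exact hne he
  · exact disjoint_left.1 (disjoint_connectedComponentIn_compl_singleton h y) hxy hx

theorem not_reducibleBetween_symm {Y : Type*} [TopologicalSpace Y] {p q : Y}
    (h : ¬ ReducibleBetween p q) : ¬ ReducibleBetween q p :=
  fun ⟨C, hC, hq, hp, hd⟩ => h ⟨C, hC, hp, hq, hd⟩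

/-! ### The separation order -/

theorem isStrictTotalOrder_mem_connectedComponentIn {Y : Type*} [TopologicalSpace Y] [T3Space Y]
    [LocallyConnectedSpace Y] [PreconnectedSpace Y] {p q : Y}
    (h : ¬ ReducibleBetween p q) :
    IsStrictTotalOrder Y fun x y => x ∈ connectedComponentIn {y}ᶜ p where
  irrefl x hx := connectedComponentIn_subset _ _ hx rfl
  trichotomous x y hxy hyx := by
    by_contra hne
    rcases mem_connectedComponentIn_compl_singleton_or h hne with hx | hx
    · exact hxy hx
    · exact hyx (mem_connectedComponentIn_compl_singleton_swap (not_reducibleBetween_symm h) hx)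
  trans x y z hxy hyz := by
    have hzy := mem_connectedComponentIn_compl_singleton_swap h hyz
    refine (isPreconnected_insert_connectedComponentIn_compl y p).subset_connectedComponentIn
      (mem_insert_connectedComponentIn_compl_singleton y p) ?_ (Or.inr hxy)
    rw [subset_compl_singleton_iff]
    rintro (he | hz)
    · exact connectedComponentIn_subset _ _ hyz he.symm
    · exact disjoint_left.1 (disjoint_connectedComponentIn_compl_singleton h y) hz hzy

/-- The identity to the order topology is a continuous bijection from a compact space to a Hausdorff
space. -/
theorem orderTopology_of_isOpen_of_compactSpace {Y : Type*} [t : TopologicalSpace Y]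
    [CompactSpace Y] [LinearOrder Y] (hlt : ∀ a : Y, IsOpen (Iio a))
    (hgt : ∀ a : Y, IsOpen (Ioi a)) : OrderTopology Y := by
  have ht : t ≤ Preorder.topology Y := by
    refine le_generateFrom ?_
    rintro _ ⟨a, rfl | rfl⟩
    exacts [hgt a, hlt a]
  refine ⟨le_antisymm ht ?_⟩
  have hT2 : @T2Space Y (Preorder.topology Y) :=
    letI := Preorder.topology Y
    haveI : OrderTopology Y := ⟨rfl⟩
    inferInstance
  have hcl := @Continuous.isClosedMap Y Y t (Preorder.topology Y) _ hT2 id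
    (continuous_id_iff_le.2 ht)
  intro s hs
  have := hcl sᶜ (@IsOpen.isClosed_compl Y t s hs)
  rw [image_id] at this
  exact (@isClosed_compl_iff Y (Preorder.topology Y) s).1 this

/-- In the separation order, `x < y` means that `x` lies in the component of `p` in `{y}ᶜ`. -/
theorem exists_linearOrder_orderTopology {Y : Type*} [TopologicalSpace Y] [CompactSpace Y]
    [T2Space Y] [LocallyConnectedSpace Y] [PreconnectedSpace Y] {p q : Y}
    (h : ¬ ReducibleBetween p q) :
    ∃ _ : LinearOrder Y, OrderTopology Y ∧ IsBot p ∧ IsTop q := by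
  classical
  have := isStrictTotalOrder_mem_connectedComponentIn h
  let L : LinearOrder Y := linearOrderOfSTO fun x y : Y => x ∈ connectedComponentIn {y}ᶜ p
  have hlt : ∀ x y : Y, x < y ↔ x ∈ connectedComponentIn {y}ᶜ p := fun _ _ => Iff.rfl
  have hgt : ∀ x y : Y, x < y ↔ y ∈ connectedComponentIn {x}ᶜ q := fun x y =>
    ⟨mem_connectedComponentIn_compl_singleton_swap h,
      mem_connectedComponentIn_compl_singleton_swap (not_reducibleBetween_symm h)⟩
  refine ⟨L, orderTopology_of_isOpen_of_compactSpace (fun a => ?_) (fun a => ?_), ?_, ?_⟩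
  · rw [show Iio a = connectedComponentIn {a}ᶜ p from Set.ext fun x => hlt x a]
    exact isOpen_compl_singleton.connectedComponentIn
  · rw [show Ioi a = connectedComponentIn {a}ᶜ q from Set.ext fun x => hgt a x]
    exact isOpen_compl_singleton.connectedComponentIn
  · intro x
    rcases eq_or_ne p x with rfl | hne
    · exact le_rfl
    · exact ((hlt p x).2 (mem_connectedComponentIn hne)).le
  · intro x
    rcases eq_or_ne q x with rfl | hne
    · exact le_rfl
    · exact ((hgt x q).2 (mem_connectedComponentIn hne)).le

/-! ### Connected separable orders with end points -/

/-- The points of a countable dense set other than the two ends are ordered like `ℚ`; the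
isomorphism sends `y` to the supremum of the rationals attached to the points of this set below
`y`. -/
theorem exists_orderIso_ereal {Y : Type*} [TopologicalSpace Y] [LinearOrder Y] [BoundedOrder Y]
    [OrderTopology Y] [PreconnectedSpace Y] [SeparableSpace Y] [Nontrivial Y] :
    Nonempty (Y ≃o EReal) := by
  have : DenselyOrdered Y := denselyOrdered_of_preconnectedSpace
  obtain ⟨D, hDc, hD⟩ := exists_countable_dense Y
  have hbtw : ∀ x y : Y, x < y → ∃ d ∈ D ∩ Ioo ⊥ ⊤, x < d ∧ d < y := by
    intro x y hxy
    obtain ⟨d, hdD, hd⟩ := hD.exists_between hxy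
    exact ⟨d, ⟨hdD, bot_le.trans_lt hd.1, hd.2.trans_le le_top⟩, hd⟩
  have hcount : Countable ↥(D ∩ Ioo ⊥ ⊤) := (hDc.mono inter_subset_left).to_subtype
  have : DenselyOrdered ↥(D ∩ Ioo ⊥ ⊤) := ⟨fun a b hab => by
    obtain ⟨d, hd, h⟩ := hbtw a b hab
    exact ⟨⟨d, hd⟩, h⟩⟩
  have : NoMinOrder ↥(D ∩ Ioo ⊥ ⊤) := ⟨fun a => by
    obtain ⟨d, hd, h⟩ := hbtw ⊥ a a.2.2.1
    exact ⟨⟨d, hd⟩, h.2⟩⟩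
  have : NoMaxOrder ↥(D ∩ Ioo ⊥ ⊤) := ⟨fun a => by
    obtain ⟨d, hd, h⟩ := hbtw a ⊤ a.2.2.2
    exact ⟨⟨d, hd⟩, h.1⟩⟩
  have : Nonempty ↥(D ∩ Ioo ⊥ ⊤) := by
    obtain ⟨d, hd, -⟩ := hbtw ⊥ ⊤ bot_lt_top
    exact ⟨⟨d, hd⟩⟩
  obtain ⟨φ⟩ := Order.iso_of_countable_dense ↥(D ∩ Ioo ⊥ ⊤) ℚ
  have hφ : ∀ a b, a ≤ b → (((φ a : ℚ) : ℝ) : EReal) ≤ ((φ b : ℚ) : ℝ) := by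
    intro a b hab
    exact_mod_cast φ.monotone hab
  have hφ' : ∀ a b, a < b → (((φ a : ℚ) : ℝ) : EReal) < ((φ b : ℚ) : ℝ) := by
    intro a b hab
    exact_mod_cast φ.strictMono hab
  let f : Y → EReal := fun y => sSup ((fun d => (((φ d : ℚ) : ℝ) : EReal)) '' {d | (d : Y) < y})
  have hle : ∀ (d : ↥(D ∩ Ioo ⊥ ⊤)) (y : Y), (d : Y) < y → (((φ d : ℚ) : ℝ) : EReal) ≤ f y :=
    fun d y h => le_sSup ⟨d, h, rfl⟩
  have hge : ∀ (d : ↥(D ∩ Ioo ⊥ ⊤)) (y : Y), y ≤ (d : Y) → f y ≤ (((φ d : ℚ) : ℝ) : EReal) := by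
    rintro d y h
    refine sSup_le ?_
    rintro _ ⟨c, hc, rfl⟩
    exact hφ _ _ (Subtype.coe_le_coe.1 ((le_of_lt hc).trans h))
  have hmono : StrictMono f := by
    intro x y hxy
    obtain ⟨d, hd, hxd, hdy⟩ := hbtw x y hxy
    obtain ⟨c, hc, hdc, hcy⟩ := hbtw d y hdy
    exact (hge ⟨d, hd⟩ x hxd.le).trans_lt ((hφ' ⟨d, hd⟩ ⟨c, hc⟩ hdc).trans_le (hle ⟨c, hc⟩ y hcy))
  have hdense : DenseRange f := by
    refine dense_of_exists_between fun a b hab => ?_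
    obtain ⟨r, har, hrb⟩ := EReal.lt_iff_exists_rat_btwn.1 hab
    obtain ⟨s, hrs, hsb⟩ := EReal.lt_iff_exists_rat_btwn.1 hrb
    have hrs' : r < s := by exact_mod_cast hrs
    refine ⟨_, ⟨(φ.symm s : Y), rfl⟩, ?_, ?_⟩
    · have := hle (φ.symm r) (φ.symm s) (φ.symm.strictMono hrs')
      rw [φ.apply_symm_apply] at this
      exact har.trans_le this
    · have := hge (φ.symm s) (φ.symm s) le_rfl
      rw [φ.apply_symm_apply] at this
      exact this.trans_lt hsb
  -- A monotone map with dense range is continuous, so the connected range contains everything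
  -- between `f ⊥ = ⊥` and `f ⊤ = ⊤`.
  have hcont : Continuous f := hmono.monotone.continuous_of_denseRange hdense
  have hbot : f ⊥ = ⊥ := by simp [f]
  have htop : f ⊤ = ⊤ := by
    refine eq_top_iff.2 (le_of_forall_lt fun c hc => ?_)
    obtain ⟨r, hcr, -⟩ := EReal.lt_iff_exists_rat_btwn.1 hc
    have := hle (φ.symm r) ⊤ (φ.symm r).2.2.2
    rw [φ.apply_symm_apply] at this
    exact hcr.trans_le this
  have hsurj : Function.Surjective f := by
    intro c
    exact (isPreconnected_range hcont).Icc_subset ⟨⊥, rfl⟩ ⟨⊤, rfl⟩ ⟨hbot ▸ bot_le, htop ▸ le_top⟩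
  exact ⟨hmono.orderIsoOfSurjective f hsurj⟩

/-! ### Irreducible compactifications are arcs -/

theorem exists_homeomorph_ereal {Y : Type*} [TopologicalSpace Y] [CompactSpace Y]
    [T2Space Y] [LocallyConnectedSpace Y] [PreconnectedSpace Y] [SeparableSpace Y] {p q : Y}
    (hpq : p ≠ q) (h : ¬ ReducibleBetween p q) : ∃ f : Y ≃ₜ EReal, f p = ⊥ ∧ f q = ⊤ := by
  obtain ⟨_, _, hp, hq⟩ := exists_linearOrder_orderTopology h
  let _ : BoundedOrder Y := { bot := p, bot_le := hp, top := q, le_top := hq }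
  have : Nontrivial Y := ⟨p, q, hpq⟩
  obtain ⟨f⟩ := exists_orderIso_ereal (Y := Y)
  exact ⟨f.toHomeomorph, f.map_bot, f.map_top⟩

/-- The complement of a point outside the range of `e` contains this dense connected range, so it is
connected; this is impossible unless the point is `p` or `q`. -/
theorem exists_homeomorph_ereal_of_isDenseEmbedding {X Y : Type*} [TopologicalSpace X]
    [TopologicalSpace Y] [CompactSpace Y] [T2Space Y] [ConnectedSpace X] [LocallyConnectedSpace X]
    [SeparableSpace X] {e : X → Y} (he : IsDenseEmbedding e) (hF : (range e)ᶜ.Finite) {p q : Y}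
    (hpq : p ≠ q) (h : ¬ ReducibleBetween p q) :
    (range e)ᶜ ⊆ {p, q} ∧ ∃ f : Y ≃ₜ EReal, f p = ⊥ ∧ f q = ⊤ := by
  have hcl : closure (range e) = univ := he.dense.closure_range
  have hconn : ∀ S, range e ⊆ S → IsPreconnected S := fun S hS =>
    (isPreconnected_range he.continuous).subset_closure hS (hcl ▸ subset_univ S)
  have : PreconnectedSpace Y := ⟨hconn _ (subset_univ _)⟩
  have : SeparableSpace Y := he.dense.separableSpace he.continuous
  have : LocallyConnectedSpace (range e) :=
    he.isEmbedding.toHomeomorph.symm.locallyConnectedSpace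
  have : LocallyConnectedSpace Y :=
    locallyConnectedSpace_of_finite_compl (isClosed_compl_iff.1 hF.isClosed) hF
  refine ⟨fun x hx => ?_, exists_homeomorph_ereal hpq h⟩
  by_contra hxpq
  rw [mem_insert_iff, mem_singleton_iff, not_or] at hxpq
  exact not_isPreconnected_of_not_reducibleBetween h isOpen_compl_singleton (fun hx => hx rfl)
    (Ne.symm hxpq.1) (Ne.symm hxpq.2) (hconn _ (subset_compl_singleton_iff.2 hx))

/-! ### The extended real line as model -/

theorem not_reducibleBetween_bot_top {Y : Type*} [TopologicalSpace Y] [LinearOrder Y]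
    [BoundedOrder Y] [OrderClosedTopology Y] : ¬ ReducibleBetween (⊥ : Y) ⊤ := by
  rintro ⟨C, hC, hb, ht, hne⟩
  refine hne ((univ_subset_iff.1 fun x _ => subset_closure ?_))
  exact hC.isPreconnected.Icc_subset hb ht ⟨bot_le, le_top⟩

theorem ReducibleBetween.map {Y Z : Type*} [TopologicalSpace Y] [TopologicalSpace Z] (f : Y ≃ₜ Z)
    {p q : Y} (h : ReducibleBetween p q) : ReducibleBetween (f p) (f q) := by
  obtain ⟨C, hC, hp, hq, hne⟩ := h
  refine ⟨f '' C, hC.image _ f.continuous.continuousOn, mem_image_of_mem _ hp,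
    mem_image_of_mem _ hq, ?_⟩
  rw [← f.image_closure]
  intro hu
  exact hne (by rw [← f.preimage_image (closure C), hu, preimage_univ])

theorem nonempty_orderIso_Icc_ereal : Nonempty (Icc (0 : ℝ) 1 ≃o EReal) :=
  exists_orderIso_ereal

theorem connectedSpace_ereal : ConnectedSpace EReal := by
  obtain ⟨g⟩ := nonempty_orderIso_Icc_ereal
  exact g.surjective.connectedSpace g.toHomeomorph.continuous

/-- The two infinite points are exceptional for the local connectedness inherited from `ℝ`. -/
theorem locallyConnectedSpace_ereal : LocallyConnectedSpace EReal := by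
  have := connectedSpace_ereal
  have : LocallyConnectedSpace (range ((↑) : ℝ → EReal)) :=
    EReal.isEmbedding_coe.toHomeomorph.symm.locallyConnectedSpace
  refine locallyConnectedSpace_of_finite_compl EReal.isOpenEmbedding_coe.isOpen_range ?_
  rw [EReal.range_coe, compl_compl]
  exact toFinite _

theorem isIrreducibleConnected_of_homeomorph_ereal {Y : Type*} [TopologicalSpace Y]
    (f : Y ≃ₜ EReal) : IsIrreducibleConnected Y := by
  have := connectedSpace_ereal
  refine ⟨f.symm.surjective.connectedSpace f.symm.continuous, f.symm ⊥, f.symm ⊤,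
    f.symm.injective.ne bot_ne_top, fun h => ?_⟩
  have := h.map f
  rw [f.apply_symm_apply, f.apply_symm_apply] at this
  exact not_reducibleBetween_bot_top this

theorem exists_isEmbedding_Ico_ereal :
    ∃ e : Ico (0 : ℝ) 1 → EReal, IsEmbedding e ∧ range e = {⊤}ᶜ := by
  obtain ⟨g⟩ := nonempty_orderIso_Icc_ereal
  refine ⟨g ∘ inclusion Ico_subset_Icc_self,
    g.toHomeomorph.isEmbedding.comp (.inclusion Ico_subset_Icc_self), ?_⟩
  rw [range_comp, range_inclusion, ← g.map_top, ← image_singleton, ← image_compl_eq g.bijective]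
  congr 1
  ext x
  have : x = ⊤ ↔ (x : ℝ) = 1 := Subtype.ext_iff
  rw [mem_compl_singleton_iff, Ne, this]
  exact ⟨fun h => h.2.ne, fun h => ⟨x.2.1, x.2.2.lt_of_ne h⟩⟩

theorem Topology.IsEmbedding.nonempty_homeomorph_of_range_eq {X X' Y : Type*} [TopologicalSpace X]
    [TopologicalSpace X'] [TopologicalSpace Y] {e : X → Y} {e' : X' → Y} (he : IsEmbedding e)
    (he' : IsEmbedding e') (h : range e = range e') : Nonempty (X ≃ₜ X') :=
  ⟨(he.toHomeomorph.trans (.setCongr h)).trans he'.toHomeomorph.symm⟩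

/-! ### The two characterizations -/

theorem noncompactSpace_Ico : NoncompactSpace (Ico (0 : ℝ) 1) := by
  rw [← not_compactSpace_iff, ← isCompact_iff_compactSpace]
  intro h
  have h1 : (1 : ℝ) ∈ closure (Ico 0 1) := by
    rw [closure_Ico zero_ne_one]
    exact right_mem_Icc.2 zero_le_one
  rw [h.isClosed.closure_eq] at h1
  exact lt_irrefl _ h1.2

theorem nonempty_homeomorph_Ico_of_isIrreducibleConnected {X : Type*} [TopologicalSpace X]
    [SeparableSpace X] [T2Space X] [ConnectedSpace X] [LocallyConnectedSpace X]
    [LocallyCompactSpace X] [NoncompactSpace X] (h : IsIrreducibleConnected (OnePoint X)) :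
    Nonempty (X ≃ₜ Ico (0 : ℝ) 1) := by
  obtain ⟨e, he, hrange⟩ := exists_isEmbedding_Ico_ereal
  -- By symmetry, the point at infinity may be taken to be the second end.
  have key : ∀ p q : OnePoint X, p ≠ q → ¬ ReducibleBetween p q → q = OnePoint.infty →
      Nonempty (X ≃ₜ Ico (0 : ℝ) 1) := by
    rintro p _ hpq hred rfl
    obtain ⟨-, f, -, hf⟩ := exists_homeomorph_ereal_of_isDenseEmbedding (X := X)
      OnePoint.isDenseEmbedding_coe (by simp) hpq hred
    refine (f.isEmbedding.comp OnePoint.isOpenEmbedding_coe.isEmbedding)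
      |>.nonempty_homeomorph_of_range_eq he ?_
    rw [range_comp, hrange, ← hf, ← image_singleton, ← image_compl_eq f.bijective,
      OnePoint.compl_infty]
  obtain ⟨-, p, q, hpq, hred⟩ := h
  obtain ⟨hF, -⟩ := exists_homeomorph_ereal_of_isDenseEmbedding (X := X)
    OnePoint.isDenseEmbedding_coe (by simp) hpq hred
  rcases hF (a := OnePoint.infty) (by simp) with hp | hq
  · exact key q p hpq.symm (not_reducibleBetween_symm hred) hp.symm
  · exact key p q hpq hred (Eq.symm hq)

theorem nonempty_homeomorph_real_of_isIrreducibleConnected {X Y : Type u} [TopologicalSpace X]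
    [TopologicalSpace Y] [SeparableSpace X] [ConnectedSpace X] [LocallyConnectedSpace X]
    {e : X → Y} (he : IsTwoPointCompactification e) (h : IsIrreducibleConnected Y) :
    Nonempty (X ≃ₜ ℝ) := by
  have := he.compact
  have := he.hausdorff
  obtain ⟨-, p, q, hpq, hred⟩ := h
  have hfin : (range e)ᶜ.Finite := finite_of_encard_eq_coe he.remainder
  obtain ⟨hF, f, hfp, hfq⟩ :=
    exists_homeomorph_ereal_of_isDenseEmbedding he.isDenseEmbedding hfin hpq hred
  have hrange : (range e)ᶜ = {p, q} :=
    hfin.eq_of_subset_of_encard_le hF (by rw [he.remainder, encard_pair hpq])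
  refine (f.isEmbedding.comp he.isDenseEmbedding.isEmbedding).nonempty_homeomorph_of_range_eq
    EReal.isEmbedding_coe ?_
  rw [range_comp, EReal.range_coe, ← hfp, ← hfq, ← image_pair, ← image_compl_eq f.bijective,
    ← hrange, compl_compl]

theorem isIrreducibleConnected_onePoint_of_homeomorph_Ico {X : Type*} [TopologicalSpace X]
    (g : X ≃ₜ Ico (0 : ℝ) 1) : IsIrreducibleConnected (OnePoint X) := by
  obtain ⟨e, he, hrange⟩ := exists_isEmbedding_Ico_ereal
  exact isIrreducibleConnected_of_homeomorph_ereal <|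
    OnePoint.equivOfIsEmbeddingOfRangeEq ⊤ (e ∘ g) (he.comp g.isEmbedding)
      (by rw [g.surjective.range_comp, hrange])

/-- The extended real line is lifted because the compactification must live in the universe of
`X`. -/
theorem isTwoPointCompactification_ereal {X : Type u} [TopologicalSpace X] (g : X ≃ₜ ℝ) :
    IsTwoPointCompactification fun x => ULift.up.{u} (g x : EReal) where
  compact := inferInstance
  hausdorff := inferInstance
  isDenseEmbedding :=
    have he := Homeomorph.ulift.{u}.symm.isEmbedding.comp
      (EReal.isEmbedding_coe.comp g.isEmbedding)
    have hd : DenseRange ((↑) : ℝ → EReal) :=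
      Dense.mono (s₁ := range fun r : ℚ => ((r : ℝ) : EReal))
        (range_subset_iff.2 fun r => ⟨r, rfl⟩) EReal.denseRange_ratCast
    { he with
      dense := Homeomorph.ulift.{u}.symm.surjective.denseRange.comp
        (hd.comp g.surjective.denseRange EReal.isEmbedding_coe.continuous)
        Homeomorph.ulift.{u}.symm.continuous
      injective := he.injective }
  remainder := by
    have hrange : range (fun x => ULift.up.{u} (g x : EReal)) = {ULift.up ⊥, ULift.up ⊤}ᶜ := by
      ext ⟨y⟩
      have : y ∈ range ((↑) : ℝ → EReal) ↔ y ∈ ({⊥, ⊤}ᶜ : Set EReal) := by rw [EReal.range_coe]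
      simpa [g.surjective.exists, ULift.ext_iff] using this
    rw [hrange, compl_compl, encard_pair]
    simp

theorem mainTheorem6 (X : Type u) [TopologicalSpace X] [SeparableSpace X] [MetrizableSpace X] :
    ((ConnectedSpace X ∧ LocallyConnectedSpace X ∧ LocallyCompactSpace X ∧
        NoncompactSpace X ∧ IsIrreducibleConnected (OnePoint X)) ↔
      Nonempty (X ≃ₜ Ico (0 : ℝ) 1)) ∧
    ((ConnectedSpace X ∧ LocallyConnectedSpace X ∧ LocallyCompactSpace X ∧
        ∃ (Y : Type u) (_ : TopologicalSpace Y) (e : X → Y),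
          IsTwoPointCompactification e ∧ IsIrreducibleConnected Y) ↔
      Nonempty (X ≃ₜ ℝ)) := by
  refine ⟨⟨?_, ?_⟩, ⟨?_, ?_⟩⟩
  · rintro ⟨_, _, _, _, h⟩
    exact nonempty_homeomorph_Ico_of_isIrreducibleConnected h
  · rintro ⟨g⟩
    have : ConnectedSpace (Ico (0 : ℝ) 1) :=
      isConnected_iff_connectedSpace.1 (isConnected_Ico one_pos)
    have := noncompactSpace_Ico
    have := locallyConnectedSpace_ereal
    obtain ⟨e, he, hrange⟩ := exists_isEmbedding_Ico_ereal
    have he : IsOpenEmbedding e := ⟨he, hrange ▸ isOpen_compl_singleton⟩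
    have heg : IsOpenEmbedding (e ∘ g) := he.comp g.isOpenEmbedding
    exact ⟨g.symm.surjective.connectedSpace g.symm.continuous, heg.locallyConnectedSpace,
      heg.locallyCompactSpace, g.symm.isClosedEmbedding.noncompactSpace,
      isIrreducibleConnected_onePoint_of_homeomorph_Ico g⟩
  · rintro ⟨_, _, _, Y, _, e, he, h⟩
    exact nonempty_homeomorph_real_of_isIrreducibleConnected he h
  · rintro ⟨g⟩
    exact ⟨g.symm.surjective.connectedSpace g.symm.continuous, g.locallyConnectedSpace,
      g.isOpenEmbedding.locallyCompactSpace, ULift.{u} EReal, inferInstance, _,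
      isTwoPointCompactification_ereal g,
      isIrreducibleConnected_of_homeomorph_ereal Homeomorph.ulift⟩
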